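/- Let \(N \ge 1\) and \(d \ge 1\) be integers, and let \(P_0,\dots,P_N \in \mathbb{C}[X_0,\dots,X_N]\) be homogeneous polynomials of degree \(d\) whose only common zero in \(\mathbb{C}^{N+1}\) is the origin (equivalently, \([P_0:\dots:P_N]\) defines a finite endomorphism \(f\) of \(\mathbb{P}^N\)). For \(m,n \in \mathbb{Z}\), let \(\mathbb{C}[Y,X]_{m,n}\) be the space of polynomials in \(Y=(Y_0,\dots,Y_N)\) and \(X=(X_0,\dots,X_N)\) that are bihomogeneous of degree \(m\) in \(Y\) and degree \(n\) in \(X\) (it is \(0\) if \(m<0\) or \(n<0\)). Then for all natural numbers \(m,n\ge 0\): (1) the linear map \[ \delta(f)_{m,n} \colon \mathbb{C}[Y,X]_{m,n} \longrightarrow \mathbb{C}[Y,X]_{m-1,n+d}, \qquad A \longmapsto \sum_{i=0}^{N} P_i(X)\,\frac{\partial A}{\partial Y_i}, \] is injective if and only if \(dm > n\) (so it is injective as soon as \(dm>n\), and this bound is sharp); (2) equivalently, the equation \(\sum_{i=0}^{N} P_i \,\partial A/\partial Y_i = 0\) has a nonzero solution \(A \in \mathbb{C}[Y,X]_{m,n}\)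 if and only if \(dm \le n\). -/

import Mathlib

open MvPolynomial

noncomputable section

/-- The polynomial ring `ℂ[Y, X] = ℂ[Y₀, …, Y_N, X₀, …, X_N]`.
The variable `Y_i` is `X (Sum.inl i)` and the variable `X_i` is `X (Sum.inr i)`. -/
abbrev PolyYX (N : ℕ) : Type := MvPolynomial (Fin (N + 1) ⊕ Fin (N + 1)) ℂ

/-- The bidegrees of the variables: `Y_i` has bidegree `(1, 0)`, `X_i` has bidegree `(0, 1)`. -/
def bidegreeWeight (N : ℕ) : Fin (N + 1) ⊕ Fin (N + 1) → ℤ × ℤ :=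
  Sum.elim (fun _ => (1, 0)) (fun _ => (0, 1))

/-- The space `ℂ[Y, X]_{m,n}` of bihomogeneous polynomials of degree `m` in `Y` and `n` in `X`.
It is `0` as soon as `m` or `n` is negative. -/
def bihomogeneous (N : ℕ) (m n : ℤ) : Submodule ℂ (PolyYX N) :=
  weightedHomogeneousSubmodule ℂ (bidegreeWeight N) (m, n)

/-- The operator `∑ i, P_i(X) ∂/∂Y_i` on `ℂ[Y, X]`. -/
def deltaOp {N : ℕ} (P : Fin (N + 1) → MvPolynomial (Fin (N + 1)) ℂ) :
    PolyYX N →ₗ[ℂ] PolyYX N :=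
  ∑ i, LinearMap.mulLeft ℂ (rename Sum.inr (P i)) ∘ₗ (pderiv (Sum.inl i)).toLinearMap

theorem deltaOp_apply {N : ℕ} (P : Fin (N + 1) → MvPolynomial (Fin (N + 1)) ℂ)
    (A : PolyYX N) :
    deltaOp P A = ∑ i, rename Sum.inr (P i) * pderiv (Sum.inl i) A := by
  simp [deltaOp, LinearMap.sum_apply]

theorem rename_inr_mem_bihomogeneous {N d : ℕ} {p : MvPolynomial (Fin (N + 1)) ℂ}
    (hp : p.IsHomogeneous d) :
    (rename Sum.inr p : PolyYX N) ∈ bihomogeneous N 0 d := by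
  rw [bihomogeneous, mem_weightedHomogeneousSubmodule]
  intro e he
  obtain ⟨u, rfl, hu⟩ := coeff_rename_ne_zero _ _ _ he
  have h := hp hu
  rw [Finsupp.weight_apply, Finsupp.sum_mapDomain_index (by simp)
    (by intros; simp [add_smul])]
  rw [Finsupp.weight_apply] at h
  simp only [bidegreeWeight, Sum.elim_inr, Finsupp.sum] at h ⊢
  rw [← h]
  ext <;> simp [Prod.fst_sum, Prod.snd_sum]

/-- If the `P_i` are homogeneous of degree `d`, the operator maps bidegree `(m, n)` to bidegree
`(m - 1, n + d)`. -/
theorem deltaOp_mem {N d : ℕ} {P : Fin (N + 1) → MvPolynomial (Fin (N + 1)) ℂ}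
    (hP : ∀ i, (P i).IsHomogeneous d) (m n : ℤ) :
    ∀ A ∈ bihomogeneous N m n, deltaOp P A ∈ bihomogeneous N (m - 1) (n + d) := by
  intro A hA
  rw [deltaOp_apply]
  refine Submodule.sum_mem _ fun i _ => ?_
  have h1 : IsWeightedHomogeneous (bidegreeWeight N) (pderiv (Sum.inl i) A) (m - 1, n) :=
    IsWeightedHomogeneous.pderiv (n := (m, n)) hA (by simp [bidegreeWeight])
  have h2 : IsWeightedHomogeneous (bidegreeWeight N) (rename Sum.inr (P i)) ((0, d) : ℤ × ℤ) :=
    rename_inr_mem_bihomogeneous (hP i)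
  have h3 := h2.mul h1
  rw [bihomogeneous, mem_weightedHomogeneousSubmodule]
  convert h3 using 1
  ext <;> simp [add_comm]

/-- The linear map `ℂ[Y, X]_{m,n} → ℂ[Y, X]_{m-1,n+d}` induced by `∑ i, P_i(X) ∂/∂Y_i`. -/
def deltaMap {N d : ℕ} (P : Fin (N + 1) → MvPolynomial (Fin (N + 1)) ℂ)
    (hP : ∀ i, (P i).IsHomogeneous d) (m n : ℤ) :
    bihomogeneous N m n →ₗ[ℂ] bihomogeneous N (m - 1) (n + d) :=
  (deltaOp P).restrict (deltaOp_mem hP m n)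

end

/-!
Write `δ_P = ∑ i, P_i(X) ∂/∂Y_i`.

If `d * m ≤ n`, the derivation `δ_P` kills the `2 × 2` minors `Y_i P_j - Y_j P_i`, which have
bidegree `(1, d)`, and all polynomials in `X`; hence the product of the `m`-th power of a nonzero
minor with a power of `X_0` is a nonzero element of the kernel of bidegree `(m, n)`.

Injectivity for `n < d * m` is first proved for `P = X`, where `d = 1`. There `δ_X` and
`∑ i, Y_i ∂/∂X_i` are the raising and lowering operators of an `sl₂`-action on `ℂ[Y, X]`, with
weight `deg_X - deg_Y`. The lowering operator is locally nilpotent, so that there is no nonzero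
vector of negative weight killed by `δ_X` (`eq_zero_of_deltaDerivation_X_eq_zero`).

The general case is reduced to this one by a norm along the substitution `φ : X_i ↦ P_i(X)`,
which satisfies `δ_P ∘ φ = φ ∘ δ_X`. By the Nullstellensatz and a graded Nakayama argument `φ` is
integral (`isIntegral_substX`), and comparison of transcendence degrees shows that it is injective
(`MvPolynomial.injective_of_isIntegral`). Let `A` be a nonzero element of bidegree `(m, n)` with
`δ_P A = 0`, and let `p` be its minimal polynomial over `ℂ[Y, X]`, viewed as a subring by `φ`; it
divides every polynomial vanishing at `A` because `ℂ[Y, X]` is integrally closed. Applying `δ_P` to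
`p(A) = 0` gives an equation of smaller degree, so `δ_X` kills the coefficients of `p`; taking
components of bidegree `r (m, n)`, where `r` is the degree of `p`, shows that the constant
coefficient of `p` has degree `r m` in `Y` and `r n / d < r m` in `X`. By the case `P = X` it
vanishes, which contradicts the minimality of `p`.
-/

open MvPolynomial

noncomputable section

/-! ### Integral ring homomorphisms -/

/-- An integral endomorphism of a polynomial ring in finitely many variables is injective: the
images of the variables generate a subalgebra of full transcendence degree, so they are
algebraically independent. -/
theorem MvPolynomial.injective_of_isIntegral {σ K : Type} [Finite σ] [Field K]
    (φ : MvPolynomial σ K →ₐ[K] MvPolynomial σ K) (hφ : φ.toRingHom.IsIntegral) :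
    Function.Injective φ := by
  have hrange : Algebra.adjoin K (Set.range fun i => φ (X i)) = φ.range := by
    rw [← Algebra.map_top, ← MvPolynomial.adjoin_range_X, AlgHom.map_adjoin, ← Set.range_comp]
    rfl
  have hint : Algebra.IsIntegral (Algebra.adjoin K (Set.range fun i => φ (X i)))
      (MvPolynomial σ K) := by
    rw [hrange]
    refine ⟨fun a => ?_⟩
    have h : (φ.range.val.toRingHom.comp φ.rangeRestrict.toRingHom).IsIntegralElem a := hφ a
    exact RingHom.IsIntegralElem.of_comp h
  have hbasis := Algebra.IsAlgebraic.isTranscendenceBasis_of_lift_le_trdeg_of_finite K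
    (fun i => φ (X i)) (by rw [MvPolynomial.trdeg_of_isDomain]; simp)
  have h : Function.Injective (aeval (R := K) fun i => φ (X i)) := hbasis.1
  rwa [show aeval (R := K) (fun i => φ (X i)) = φ by ext; simp] at h

/-- For an injective ring homomorphism `φ : R → S` of domains with `R` integrally closed, an element
of `S` integral over `R` is a root of a monic polynomial over `R` whose degree is least among all
nonzero polynomials vanishing there. -/
theorem RingHom.IsIntegralElem.exists_monic_minimal {R S : Type*} [CommRing R] [IsDomain R]
    [IsIntegrallyClosed R] [CommRing S] [IsDomain S] {φ : R →+* S} (hφ : Function.Injective φ)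
    {s : S} (hs : φ.IsIntegralElem s) :
    ∃ p : Polynomial R, p.Monic ∧ p.eval₂ φ s = 0 ∧
      ∀ q : Polynomial R, q.eval₂ φ s = 0 → q.degree < p.degree → q = 0 := by
  algebraize [φ]
  have : FaithfulSMul R S := (faithfulSMul_iff_algebraMap_injective R S).2 hφ
  have hs' : _root_.IsIntegral R s := hs
  refine ⟨minpoly R s, minpoly.monic hs', minpoly.aeval R s, fun q hq hlt => ?_⟩
  exact Polynomial.eq_zero_of_dvd_of_degree_lt (minpoly.isIntegrallyClosed_dvd hs' hq) hlt

theorem Derivation.finset_sum_apply {R A M ι : Type*} [CommSemiring R] [CommSemiring A]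
    [AddCommMonoid M] [Algebra R A] [Module A M] [Module R M] (s : Finset ι)
    (D : ι → Derivation R A M) (a : A) :
    (∑ i ∈ s, D i) a = ∑ i ∈ s, D i a := by
  classical
  induction s using Finset.induction_on with
  | empty => simp
  | insert i s hi ih => simp [Finset.sum_insert hi, ih]

/-! ### The derivation and the substitution -/

variable {N d : ℕ}

/-- The operator `∑ i, P_i(X) ∂/∂Y_i` as a derivation. -/
def deltaDerivation (P : Fin (N + 1) → MvPolynomial (Fin (N + 1)) ℂ) :
    Derivation ℂ (PolyYX N) (PolyYX N) :=
  ∑ i, (rename Sum.inr (P i) : PolyYX N) • pderiv (Sum.inl i)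

theorem deltaDerivation_apply (P : Fin (N + 1) → MvPolynomial (Fin (N + 1)) ℂ) (A : PolyYX N) :
    deltaDerivation P A = ∑ i, rename Sum.inr (P i) * pderiv (Sum.inl i) A := by
  simp [deltaDerivation, Derivation.finset_sum_apply]

@[simp]
theorem deltaDerivation_X_inl (P : Fin (N + 1) → MvPolynomial (Fin (N + 1)) ℂ) (i : Fin (N + 1)) :
    deltaDerivation P (X (Sum.inl i)) = rename Sum.inr (P i) := by
  rw [deltaDerivation_apply, Finset.sum_eq_single i] <;>
    simp +contextual [pderiv_X, eq_comm]

@[simp]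
theorem deltaDerivation_X_inr (P : Fin (N + 1) → MvPolynomial (Fin (N + 1)) ℂ) (i : Fin (N + 1)) :
    deltaDerivation P (X (Sum.inr i)) = 0 := by
  simp [deltaDerivation_apply, pderiv_X]

theorem Derivation.apply_rename_eq_zero {σ τ R : Type*} [CommRing R]
    (D : Derivation R (MvPolynomial τ R) (MvPolynomial τ R)) {f : σ → τ}
    (hD : ∀ i, D (X (f i)) = 0) (p : MvPolynomial σ R) : D (rename f p) = 0 := by
  induction p using MvPolynomial.induction_on with
  | C a => rw [rename_C, MvPolynomial.derivation_C]
  | add p q hp hq => rw [map_add, map_add, hp, hq, add_zero]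
  | mul_X p i hp => simp [hp, hD]

theorem deltaDerivation_rename_inr (P : Fin (N + 1) → MvPolynomial (Fin (N + 1)) ℂ)
    (p : MvPolynomial (Fin (N + 1)) ℂ) : deltaDerivation P (rename Sum.inr p) = 0 :=
  Derivation.apply_rename_eq_zero _ (by simp) p

/-- The endomorphism of `ℂ[Y, X]` given by `Y_i ↦ Y_i` and `X_i ↦ P_i(X)`. -/
def substX (P : Fin (N + 1) → MvPolynomial (Fin (N + 1)) ℂ) : PolyYX N →ₐ[ℂ] PolyYX N :=
  aeval (Sum.elim (fun i => X (Sum.inl i)) fun i => rename Sum.inr (P i))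

@[simp]
theorem substX_X_inl (P : Fin (N + 1) → MvPolynomial (Fin (N + 1)) ℂ) (i : Fin (N + 1)) :
    substX P (X (Sum.inl i)) = X (Sum.inl i) := by
  simp [substX]

@[simp]
theorem substX_X_inr (P : Fin (N + 1) → MvPolynomial (Fin (N + 1)) ℂ) (i : Fin (N + 1)) :
    substX P (X (Sum.inr i)) = rename Sum.inr (P i) := by
  simp [substX]

@[simp]
theorem substX_rename_inr (P : Fin (N + 1) → MvPolynomial (Fin (N + 1)) ℂ)
    (p : MvPolynomial (Fin (N + 1)) ℂ) :
    substX P (rename Sum.inr p) = rename Sum.inr (aeval P p) := by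
  induction p using MvPolynomial.induction_on with
  | C a => simp [substX]
  | add p q hp hq => simp only [map_add, hp, hq]
  | mul_X p i hp => simp only [map_mul, hp, rename_X, substX_X_inr, aeval_X]

/-- Substitution intertwines `∑ i, X_i ∂/∂Y_i` with `∑ i, P_i(X) ∂/∂Y_i`. -/
theorem deltaDerivation_substX (P : Fin (N + 1) → MvPolynomial (Fin (N + 1)) ℂ) (c : PolyYX N) :
    deltaDerivation P (substX P c) = substX P (deltaDerivation X c) := by
  induction c using MvPolynomial.induction_on with
  | C a => simp [substX, MvPolynomial.derivation_C, ← MvPolynomial.algebraMap_eq]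
  | add p q hp hq => simp [hp, hq]
  | mul_X p i hp =>
    rcases i with i | i <;> simp [hp, deltaDerivation_rename_inr]

/-! ### The case `P = X` -/

/-- `∑ i, Y_i ∂/∂X_i`, opposite to `∑ i, X_i ∂/∂Y_i`. -/
def polarization (N : ℕ) : Derivation ℂ (PolyYX N) (PolyYX N) :=
  ∑ i, (X (Sum.inl i) : PolyYX N) • pderiv (Sum.inr i)

theorem polarization_apply (A : PolyYX N) :
    polarization N A = ∑ i, X (Sum.inl i) * pderiv (Sum.inr i) A := by
  simp [polarization, Derivation.finset_sum_apply]

@[simp]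
theorem polarization_X_inr (i : Fin (N + 1)) :
    polarization N (X (Sum.inr i)) = X (Sum.inl i) := by
  rw [polarization_apply, Finset.sum_eq_single i] <;>
    simp +contextual [pderiv_X, eq_comm]

@[simp]
theorem polarization_X_inl (i : Fin (N + 1)) : polarization N (X (Sum.inl i)) = 0 := by
  simp [polarization_apply, pderiv_X]

theorem polarization_mem {a b : ℤ} {c : PolyYX N} (hc : c ∈ bihomogeneous N a b) :
    polarization N c ∈ bihomogeneous N (a + 1) (b - 1) := by
  rw [polarization_apply]
  refine Submodule.sum_mem _ fun i _ => ?_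
  have h1 : IsWeightedHomogeneous (bidegreeWeight N) (pderiv (Sum.inr i) c) (a, b - 1) :=
    IsWeightedHomogeneous.pderiv (n := (a, b)) hc (by simp [bidegreeWeight])
  have h := (isWeightedHomogeneous_X ℂ (bidegreeWeight N) (Sum.inl i)).mul h1
  rw [bihomogeneous, mem_weightedHomogeneousSubmodule]
  convert h using 1
  ext <;> simp [bidegreeWeight, add_comm]

theorem eq_zero_of_mem_bihomogeneous_of_neg {a b : ℤ} (hb : b < 0) {c : PolyYX N}
    (hc : c ∈ bihomogeneous N a b) : c = 0 := by
  ext e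
  by_contra he
  have h := congrArg Prod.snd (hc he)
  rw [Finsupp.weight_apply, Finsupp.sum, Prod.snd_sum] at h
  have : 0 ≤ ∑ i ∈ e.support, (e i • bidegreeWeight N i).2 :=
    Finset.sum_nonneg fun i _ => by rcases i with i | i <;> simp [bidegreeWeight]
  simp only at h
  omega

/-- The commutator of the two operators is the Euler operator `deg_X - deg_Y`. -/
theorem lie_deltaDerivation_polarization {a b : ℤ} {c : PolyYX N}
    (hc : c ∈ bihomogeneous N a b) :
    deltaDerivation X (polarization N c) - polarization N (deltaDerivation X c) =
      ((b - a : ℤ) : ℂ) • c := by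
  let H : Derivation ℂ (PolyYX N) (PolyYX N) :=
    ∑ i, (X (Sum.inr i) : PolyYX N) • pderiv (Sum.inr i) -
      ∑ i, (X (Sum.inl i) : PolyYX N) • pderiv (Sum.inl i)
  have hHapply : ∀ A, H A = ∑ i, X (Sum.inr i) * pderiv (Sum.inr i) A -
      ∑ i, X (Sum.inl i) * pderiv (Sum.inl i) A := by
    intro A
    simp [H, Derivation.finset_sum_apply]
  have hD : ⁅(deltaDerivation X : Derivation ℂ (PolyYX N) (PolyYX N)), polarization N⁆ = H := by
    refine MvPolynomial.derivation_ext fun i => ?_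
    rw [hHapply, Derivation.commutator_apply]
    rcases i with i | i <;> simp [pderiv_X, Pi.single_apply]
  have hmon : ∀ (e : Fin (N + 1) ⊕ Fin (N + 1) →₀ ℕ) (r : ℂ),
      H (monomial e r) = (((Finsupp.weight (bidegreeWeight N) e).2 -
        (Finsupp.weight (bidegreeWeight N) e).1 : ℤ) : ℂ) • monomial e r := by
    intro e r
    simp_rw [hHapply, X_mul_pderiv_monomial, ← Finset.sum_smul, Finsupp.weight_apply]
    rw [Finsupp.sum_fintype _ _ (by simp), Fintype.sum_sum_type]
    simp [bidegreeWeight, Prod.fst_sum, Prod.snd_sum, sub_smul, Finset.sum_smul,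
      Nat.cast_smul_eq_nsmul]
  rw [← Derivation.commutator_apply, hD]
  conv_lhs => rw [c.as_sum]
  conv_rhs => rw [c.as_sum]
  rw [map_sum, Finset.smul_sum]
  refine Finset.sum_congr rfl fun e he => ?_
  rw [hmon, hc (mem_support_iff.1 he)]

/-- The operator `∑ i, X_i ∂/∂Y_i` is injective in bidegree `(a, b)` for `b < a`. Together with
`polarization N` it spans a copy of `sl₂`, and a highest weight vector of negative weight `b - a`
that is killed by a power of the lowering operator vanishes. -/
theorem eq_zero_of_deltaDerivation_X_eq_zero {a b : ℤ} (hab : b < a) {c : PolyYX N}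
    (hc : c ∈ bihomogeneous N a b) (h0 : deltaDerivation X c = 0) : c = 0 := by
  have hmem : ∀ k : ℕ, (polarization N)^[k] c ∈ bihomogeneous N (a + k) (b - k) := by
    intro k
    induction k with
    | zero => simpa
    | succ k ih =>
      rw [Function.iterate_succ_apply']
      convert polarization_mem ih using 1
      push_cast; ring_nf
  have hE : ∀ k : ℕ, deltaDerivation X ((polarization N)^[k + 1] c) =
      (((k + 1) * (b - a - k) : ℤ) : ℂ) • (polarization N)^[k] c := by
    intro k
    induction k with
    | zero =>
      have := lie_deltaDerivation_polarization hc
      simpa [h0] using this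
    | succ k ih =>
      have := lie_deltaDerivation_polarization (hmem (k + 1))
      rw [ih, Derivation.map_smul, ← Function.iterate_succ_apply' (polarization N),
        ← Function.iterate_succ_apply' (polarization N)] at this
      rw [sub_eq_iff_eq_add.1 this, ← add_smul]
      congr 1
      push_cast
      ring
  have hdown : ∀ k : ℕ, (polarization N)^[k] c = 0 → c = 0 := by
    intro k
    induction k with
    | zero => exact id
    | succ k ih =>
      intro h
      apply ih
      have hk := hE k
      rw [h, map_zero] at hk
      refine (smul_eq_zero.1 hk.symm).resolve_left ?_
      have : ((k : ℤ) + 1) * (b - a - k) ≠ 0 := mul_ne_zero (by omega) (by omega)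
      exact_mod_cast this
  exact hdown (b.toNat + 1)
    (eq_zero_of_mem_bihomogeneous_of_neg (by omega) (hmem _))

/-! ### Finiteness of the substitution -/

section Integral

variable {σ K : Type*} [Field K]

/-- If the polynomials of a family have no common zero except possibly the origin, every variable
is nilpotent modulo the ideal they generate. -/
theorem MvPolynomial.exists_X_pow_mem_span [Finite σ] [IsAlgClosed K] {ι : Type*}
    (P : ι → MvPolynomial σ K) (hzero : ∀ x : σ → K, (∀ i, eval x (P i) = 0) → x = 0) :
    ∃ k, ∀ i, (X i : MvPolynomial σ K) ^ k ∈ Ideal.span (Set.range P) := by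
  have hrad : ∀ i, ∃ k, (X i : MvPolynomial σ K) ^ k ∈ Ideal.span (Set.range P) := by
    intro i
    change X i ∈ (Ideal.span (Set.range P)).radical
    rw [← vanishingIdeal_zeroLocus_eq_radical (K := K), mem_vanishingIdeal_iff]
    intro x hx
    have : x = 0 := hzero x fun j => by
      have := hx (P j) (Ideal.subset_span ⟨j, rfl⟩)
      simpa [aeval_eq_eval] using this
    simp [this]
  choose k hk using hrad
  have := Fintype.ofFinite σ
  exact ⟨∑ i, k i, fun i =>
    Ideal.pow_mem_of_pow_mem _ (hk i) (Finset.single_le_sum (f := k) (by simp) (Finset.mem_univ i))⟩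

attribute [local instance] MvPolynomial.gradedAlgebra in
theorem MvPolynomial.IsHomogeneous.homogeneousComponent_mul {p : MvPolynomial σ K} {d n : ℕ}
    (hp : p.IsHomogeneous d) (hdn : d ≤ n) (q : MvPolynomial σ K) :
    homogeneousComponent n (p * q) = p * homogeneousComponent (n - d) q := by
  have h := DirectSum.coe_decompose_mul_of_left_mem_of_le (homogeneousSubmodule σ K) (b := q)
    ((mem_homogeneousSubmodule d p).2 hp) hdn
  rwa [show DirectSum.decompose (homogeneousSubmodule σ K) (p * q) =
      MvPolynomial.decomposition.decompose' (p * q) from rfl,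
    show DirectSum.decompose (homogeneousSubmodule σ K) q =
      MvPolynomial.decomposition.decompose' q from rfl,
    decomposition.decompose'_apply, decomposition.decompose'_apply] at h

/-- A graded Nakayama argument: a polynomial ring is finite over the subalgebra generated by
homogeneous elements of the same positive degree, as soon as a power of every variable lies in the
ideal they generate. -/
theorem MvPolynomial.finite_range_aeval [Finite σ] {ι : Type*} [Fintype ι]
    {P : ι → MvPolynomial σ K} {d k : ℕ} (hd : 1 ≤ d) (hP : ∀ i, (P i).IsHomogeneous d)
    (hk : ∀ i, (X i : MvPolynomial σ K) ^ k ∈ Ideal.span (Set.range P)) :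
    Module.Finite (aeval (R := K) P).range (MvPolynomial σ K) := by
  have := Fintype.ofFinite σ
  set R := (aeval (R := K) P).range
  set B := Fintype.card σ * k + d
  set W : Submodule R (MvPolynomial σ K) :=
    Submodule.span R ((fun e => monomial e 1) '' {e : σ →₀ ℕ | e.degree ≤ B})
  have hPR : ∀ i, P i ∈ R := fun i => ⟨X i, by simp⟩
  have hCW : ∀ (r : K) (f : MvPolynomial σ K), f ∈ W → r • f ∈ W := fun r f hf => by
    rw [← algebraMap_smul R r f]
    exact W.smul_mem _ hf
  have hW : ∀ n (f : MvPolynomial σ K), f.IsHomogeneous n → f ∈ W := by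
    intro n
    induction n using Nat.strong_induction_on with
    | _ n ih =>
    have hmon : ∀ e : σ →₀ ℕ, e.degree = n → monomial e (1 : K) ∈ W := by
      intro e he
      by_cases hn : n ≤ B
      · exact Submodule.subset_span ⟨e, by simpa [he], rfl⟩
      -- By the pigeonhole principle some variable occurs with exponent at least `k`.
      obtain ⟨i, hi⟩ : ∃ i, k ≤ e i := by
        by_contra! h
        have : e.degree ≤ Fintype.card σ * k := by
          rw [Finsupp.degree_eq_sum, ← smul_eq_mul, ← Finset.card_univ]
          exact Finset.sum_le_card_nsmul _ _ _ fun i _ => (h i).le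
        omega
      have hmem : monomial e (1 : K) ∈ Ideal.span (Set.range P) := by
        have : monomial e (1 : K) = monomial (e - Finsupp.single i k) 1 * X i ^ k := by
          rw [X_pow_eq_monomial, monomial_mul, one_mul,
            tsub_add_cancel_of_le (by simpa using hi)]
        rw [this]
        exact Ideal.mul_mem_left _ _ (hk i)
      obtain ⟨g, hg⟩ := Ideal.mem_span_range_iff_exists_fun.1 hmem
      have hcomp : monomial e (1 : K) = ∑ j, P j * homogeneousComponent (n - d) (g j) := by
        rw [← homogeneousComponent_eq_self (isHomogeneous_monomial (1 : K) he), ← hg, map_sum]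
        refine Finset.sum_congr rfl fun j _ => ?_
        rw [mul_comm, (hP j).homogeneousComponent_mul (by omega)]
      rw [hcomp]
      exact W.sum_mem fun j _ => W.smul_mem (⟨P j, hPR j⟩ : R)
        (ih (n - d) (by omega) _ (homogeneousComponent_isHomogeneous _ _))
    intro f hf
    rw [f.as_sum]
    refine W.sum_mem fun e he => ?_
    rw [← mul_one (coeff e f), ← smul_eq_mul, ← smul_monomial]
    refine hCW _ _ (hmon e ?_)
    by_contra h
    exact mem_support_iff.1 he (hf.coeff_eq_zero h)
  have htop : W = ⊤ := by
    refine Submodule.eq_top_iff'.2 fun f => ?_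
    rw [← sum_homogeneousComponent f]
    exact W.sum_mem fun n _ => hW n _ (homogeneousComponent_isHomogeneous _ _)
  exact ⟨htop ▸ Submodule.fg_span ((Finsupp.finite_of_degree_le B).image _)⟩

/-- Homogeneous polynomials of the same positive degree without nontrivial common zero define a
finite morphism of affine spaces. -/
theorem MvPolynomial.isIntegral_aeval_of_forall_eval_eq_zero [Finite σ] [IsAlgClosed K]
    {ι : Type*} [Fintype ι] {P : ι → MvPolynomial σ K} {d : ℕ} (hd : 1 ≤ d)
    (hP : ∀ i, (P i).IsHomogeneous d) (hzero : ∀ x : σ → K, (∀ i, eval x (P i) = 0) → x = 0) :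
    (aeval (R := K) P).toRingHom.IsIntegral := by
  obtain ⟨k, hk⟩ := exists_X_pow_mem_span P hzero
  have := finite_range_aeval hd hP hk
  exact (RingHom.isIntegral_of_surjective (aeval (R := K) P).rangeRestrict.toRingHom
    (AlgHom.rangeRestrict_surjective _)).trans _ _
      (Algebra.IsIntegral.isIntegral (R := (aeval (R := K) P).range) (A := MvPolynomial σ K))

end Integral

theorem isIntegral_substX {P : Fin (N + 1) → MvPolynomial (Fin (N + 1)) ℂ} (hd : 1 ≤ d)
    (hP : ∀ i, (P i).IsHomogeneous d)
    (hzero : ∀ x : Fin (N + 1) → ℂ, (∀ i, eval x (P i) = 0) → x = 0) :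
    (substX P).toRingHom.IsIntegral := by
  have himage : ∀ c, (substX P).toRingHom.IsIntegralElem (substX P c) := fun c =>
    (substX P).toRingHom.isIntegralElem_map
  intro A
  induction A using MvPolynomial.induction_on with
  | C a => simpa [substX] using himage (C a)
  | add p q hp hq => exact hp.add _ hq
  | mul_X p i hp =>
    refine hp.mul _ ?_
    rcases i with i | i
    · simpa using himage (X (Sum.inl i))
    · obtain ⟨f, hf, h0⟩ := isIntegral_aeval_of_forall_eval_eq_zero hd hP hzero (X i)
      refine ⟨f.map (rename Sum.inr : _ →ₐ[ℂ] PolyYX N).toRingHom, hf.map _, ?_⟩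
      have hcomp : (substX P).toRingHom.comp (rename Sum.inr : _ →ₐ[ℂ] PolyYX N).toRingHom =
          (rename Sum.inr : _ →ₐ[ℂ] PolyYX N).toRingHom.comp (aeval P).toRingHom :=
        RingHom.ext fun p => substX_rename_inr P p
      have h1 := Polynomial.hom_eval₂ f (aeval P).toRingHom
        (rename Sum.inr : _ →ₐ[ℂ] PolyYX N).toRingHom (X i)
      rw [h0, map_zero] at h1
      rw [Polynomial.eval₂_map, hcomp, h1]
      simp

/-! ### Bidegrees and the substitution -/

/-- The bidegrees pulled back by the substitution `X_i ↦ P_i(X)`, where the `P_i` have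
degree `d`. -/
def pulledBackWeight (N d : ℕ) : Fin (N + 1) ⊕ Fin (N + 1) → ℤ × ℤ :=
  Sum.elim (fun _ => (1, 0)) (fun _ => (0, d))

theorem substX_monomial_isWeightedHomogeneous {P : Fin (N + 1) → MvPolynomial (Fin (N + 1)) ℂ}
    (hP : ∀ i, (P i).IsHomogeneous d) (e : Fin (N + 1) ⊕ Fin (N + 1) →₀ ℕ) (r : ℂ) :
    (substX P (monomial e r)).IsWeightedHomogeneous (bidegreeWeight N)
      (Finsupp.weight (pulledBackWeight N d) e) := by
  rw [substX, aeval_monomial, Finsupp.weight_apply]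
  refine IsWeightedHomogeneous.C_mul (IsWeightedHomogeneous.prod _ _ _ fun i _ => ?_) r
  refine IsWeightedHomogeneous.pow ?_ _
  rcases i with i | i
  · exact isWeightedHomogeneous_X ℂ (bidegreeWeight N) (Sum.inl i)
  · exact rename_inr_mem_bihomogeneous (hP i)

theorem weightedHomogeneousComponent_substX {P : Fin (N + 1) → MvPolynomial (Fin (N + 1)) ℂ}
    (hP : ∀ i, (P i).IsHomogeneous d) (μ : ℤ × ℤ) (c : PolyYX N) :
    weightedHomogeneousComponent (bidegreeWeight N) μ (substX P c) =
      substX P (weightedHomogeneousComponent (pulledBackWeight N d) μ c) := by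
  induction c using MvPolynomial.induction_on' with
  | monomial e r =>
    rw [weightedHomogeneousComponent_of_mem (substX_monomial_isWeightedHomogeneous hP e r),
      weightedHomogeneousComponent_of_mem (isWeightedHomogeneous_monomial _ e r rfl),
      apply_ite (substX P), map_zero]
  | add p q hp hq => simp only [map_add, hp, hq]

theorem MvPolynomial.IsWeightedHomogeneous.weightedHomogeneousComponent_mul {σ R M : Type*}
    [CommRing R] [AddCancelCommMonoid M] {w : σ → M} {b : MvPolynomial σ R} {j : M}
    (hb : b.IsWeightedHomogeneous w j) (i : M) (a : MvPolynomial σ R) :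
    weightedHomogeneousComponent w (i + j) (a * b) = weightedHomogeneousComponent w i a * b := by
  classical
  let := MvPolynomial.weightedGradedAlgebra R w
  have h := DirectSum.coe_decompose_mul_add_of_right_mem (weightedHomogeneousSubmodule R w) (i := i)
    (a := a) ((mem_weightedHomogeneousSubmodule R w j b).2 hb)
  rwa [show DirectSum.decompose (weightedHomogeneousSubmodule R w) (a * b) =
      (weightedDecomposition R w).decompose' (a * b) from rfl,
    show DirectSum.decompose (weightedHomogeneousSubmodule R w) a =
      (weightedDecomposition R w).decompose' a from rfl,
    weightedDecomposition.decompose'_apply, weightedDecomposition.decompose'_apply] at h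

theorem mem_bihomogeneous_of_pulledBackWeight (hd : 1 ≤ d) {a b : ℕ} {c : PolyYX N}
    (hc : c.IsWeightedHomogeneous (pulledBackWeight N d) ((a, b) : ℤ × ℤ)) :
    c ∈ bihomogeneous N a (b / d : ℕ) := by
  intro e he
  have h := hc he
  rw [Finsupp.weight_apply, Finsupp.sum_fintype _ _ (by simp), Fintype.sum_sum_type] at h ⊢
  rw [Prod.ext_iff] at h ⊢
  simp only [pulledBackWeight, bidegreeWeight, Prod.fst_add, Prod.snd_add, Prod.fst_sum,
    Prod.snd_sum, Sum.elim_inl, Sum.elim_inr, Prod.smul_mk, smul_zero, Finset.sum_const_zero,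
    add_zero, zero_add, nsmul_eq_mul, mul_one] at h ⊢
  refine ⟨h.1, ?_⟩
  have h2 : (∑ i, e (Sum.inr i)) * d = b := by
    rw [Finset.sum_mul]
    exact_mod_cast h.2
  rw [← h2, Nat.mul_div_cancel _ (by omega)]
  push_cast
  rfl

/-! ### The kernel of the derivation -/

/-- Injectivity for `n < d * m`. The constant coefficient of the minimal polynomial of a solution
`A` over the image of `substX P` is, up to sign, the norm of `A`; it is again a solution, now for the
operator `∑ i, X_i ∂/∂Y_i` and in a bidegree where that operator is injective. -/
theorem eq_zero_of_deltaDerivation_eq_zero {P : Fin (N + 1) → MvPolynomial (Fin (N + 1)) ℂ}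
    (hd : 1 ≤ d) (hP : ∀ i, (P i).IsHomogeneous d)
    (hzero : ∀ x : Fin (N + 1) → ℂ, (∀ i, eval x (P i) = 0) → x = 0)
    {m n : ℕ} (hmn : n < d * m) {A : PolyYX N} (hA : A ∈ bihomogeneous N m n)
    (h0 : deltaDerivation P A = 0) : A = 0 := by
  by_contra hA0
  have hint := isIntegral_substX hd hP hzero
  have hinj : Function.Injective (substX P).toRingHom := injective_of_isIntegral _ hint
  obtain ⟨p, hmonic, hroot, hmin⟩ := (hint A).exists_monic_minimal hinj
  set r := p.natDegree
  have hsum : ∑ i ∈ Finset.range (r + 1), substX P (p.coeff i) * A ^ i = 0 := by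
    rw [← hroot, Polynomial.eval₂_eq_sum_range]
    rfl
  have hdeg : p.degree = r := Polynomial.degree_eq_natDegree hmonic.ne_zero
  have hpr : p.coeff r = 1 := hmonic
  have heval : ∀ c : ℕ → PolyYX N, (∑ i ∈ Finset.range (r + 1),
      Polynomial.monomial i (c i)).eval₂ (substX P).toRingHom A =
      ∑ i ∈ Finset.range (r + 1), substX P (c i) * A ^ i := fun c => by
    simp [Polynomial.eval₂_finsetSum]
  have hcoeff : ∀ (c : ℕ → PolyYX N) (j : ℕ), (∑ i ∈ Finset.range (r + 1),
      Polynomial.monomial i (c i)).coeff j = if j ≤ r then c j else 0 := fun c j => by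
    simp [Polynomial.coeff_monomial]
  have hlt : ∀ q : Polynomial (PolyYX N), (∀ j, r ≤ j → q.coeff j = 0) → q.degree < p.degree :=
    fun q hq => by rw [hdeg]; exact (Polynomial.degree_lt_iff_coeff_zero q r).2 hq
  -- Differentiating the equation of `A` gives an equation of smaller degree.
  have hkill : deltaDerivation X (p.coeff 0) = 0 := by
    have h := hmin (∑ i ∈ Finset.range (r + 1),
      Polynomial.monomial i (deltaDerivation X (p.coeff i))) ?_ (hlt _ ?_)
    · have := hcoeff (fun i => deltaDerivation X (p.coeff i)) 0
      rw [h] at this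
      simpa using this.symm
    · rw [heval, ← map_zero (deltaDerivation P), ← hsum, map_sum]
      refine Finset.sum_congr rfl fun i _ => ?_
      rw [Derivation.leibniz, Derivation.leibniz_pow, h0, deltaDerivation_substX]
      simp [mul_comm]
    · intro j hj
      rw [hcoeff]
      split_ifs with h
      · rw [le_antisymm h hj, hpr, Derivation.map_one_eq_zero]
      · rfl
  -- The component of top bidegree of the equation of `A` is again a monic equation of degree `r`.
  have hhom : (p.coeff 0).IsWeightedHomogeneous (pulledBackWeight N d)
      (((r * m : ℕ), (r * n : ℕ)) : ℤ × ℤ) := by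
    set c : ℕ → PolyYX N := fun i => weightedHomogeneousComponent (pulledBackWeight N d)
      ((r - i) • ((m, n) : ℤ × ℤ)) (p.coeff i) with hc
    have h := hmin (p - ∑ i ∈ Finset.range (r + 1), Polynomial.monomial i (c i)) ?_ (hlt _ ?_)
    · have h1 := hcoeff c 0
      rw [← sub_eq_zero.1 h] at h1
      simp only [zero_le, if_true] at h1
      rw [h1]
      convert! weightedHomogeneousComponent_isWeightedHomogeneous _ _ using 1
    · rw [Polynomial.eval₂_sub, hroot, heval, zero_sub, neg_eq_zero,
        ← map_zero (weightedHomogeneousComponent (bidegreeWeight N) (r • ((m, n) : ℤ × ℤ))), ← hsum,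
        map_sum]
      refine Finset.sum_congr rfl fun i hi => ?_
      have hAi : (A ^ i).IsWeightedHomogeneous (bidegreeWeight N) (i • ((m, n) : ℤ × ℤ)) :=
        IsWeightedHomogeneous.pow hA i
      have hir : i ≤ r := Nat.lt_succ_iff.1 (Finset.mem_range.1 hi)
      rw [hc, ← weightedHomogeneousComponent_substX hP, ← hAi.weightedHomogeneousComponent_mul,
        ← add_smul, Nat.sub_add_cancel hir]
    · intro j hj
      rw [Polynomial.coeff_sub, hcoeff]
      split_ifs with h
      · simp only [le_antisymm h hj, hc, tsub_self, zero_smul]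
        rw [hpr, weightedHomogeneousComponent_eq_self (isWeightedHomogeneous_one _ _), sub_self]
      · rw [Polynomial.coeff_eq_zero_of_natDegree_lt (by omega), sub_zero]
  have hr0 : 0 < r := by
    by_contra hr0
    have hr0 : r = 0 := by omega
    rw [hr0] at hsum hpr
    simp [hpr] at hsum
  have hzero0 : p.coeff 0 = 0 := by
    refine eq_zero_of_deltaDerivation_X_eq_zero ?_
      (mem_bihomogeneous_of_pulledBackWeight hd hhom) hkill
    have : r * n / d < r * m := by
      rw [Nat.div_lt_iff_lt_mul (by omega)]
      calc r * n < r * (d * m) := Nat.mul_lt_mul_of_pos_left hmn hr0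
        _ = r * m * d := by ring
    exact_mod_cast this
  -- A vanishing constant term would allow dividing the equation by `A`.
  obtain ⟨q, hq⟩ := Polynomial.X_dvd_iff.2 hzero0
  have hq0 : q ≠ 0 := by
    rintro rfl
    exact hmonic.ne_zero (by simpa using hq)
  refine hq0 (hmin q ?_ ?_)
  · rw [hq, Polynomial.eval₂_mul, Polynomial.eval₂_X] at hroot
    exact (mul_eq_zero.1 hroot).resolve_left hA0
  · rw [hq, mul_comm]
    exact Polynomial.degree_lt_degree_mul_X hq0

/-- Sharpness: `(Y_i P_j - Y_j P_i) ^ m` times a power of `X_0` is a nonzero solution. -/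
theorem exists_ne_zero_deltaDerivation_eq_zero {P : Fin (N + 1) → MvPolynomial (Fin (N + 1)) ℂ}
    (hN : 1 ≤ N) (hP : ∀ i, (P i).IsHomogeneous d)
    (hzero : ∀ x : Fin (N + 1) → ℂ, (∀ i, eval x (P i) = 0) → x = 0)
    {m n : ℕ} (hmn : d * m ≤ n) :
    ∃ A ∈ bihomogeneous N m n, A ≠ 0 ∧ deltaDerivation P A = 0 := by
  obtain ⟨j, hj⟩ : ∃ j, P j ≠ 0 := by
    by_contra! h
    exact one_ne_zero (congrFun (hzero 1 fun i => by simp [h i]) 0)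
  have : Nontrivial (Fin (N + 1)) := Fin.nontrivial_iff_two_le.2 (by omega)
  obtain ⟨i, hij⟩ := exists_ne j
  set F : PolyYX N := X (Sum.inl i) * rename Sum.inr (P j) -
    X (Sum.inl j) * rename Sum.inr (P i) with hF
  have hFmem : F.IsWeightedHomogeneous (bidegreeWeight N) ((1, d) : ℤ × ℤ) := by
    have h : ∀ k l, (X (Sum.inl k) * rename Sum.inr (P l) : PolyYX N).IsWeightedHomogeneous
        (bidegreeWeight N) ((1, d) : ℤ × ℤ) := fun k l => by
      convert! (isWeightedHomogeneous_X ℂ (bidegreeWeight N) (Sum.inl k)).mul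
        (rename_inr_mem_bihomogeneous (hP l)) using 1
      simp [bidegreeWeight]
    exact (h i j).sub (h j i)
  have hF0 : F ≠ 0 := by
    intro h
    -- The derivative of `F` with respect to `Y_i` is `P_j`.
    have h1 := congrArg (pderiv (Sum.inl i)) h
    have h2 : ∀ p, pderiv (Sum.inl i) (rename Sum.inr p : PolyYX N) = 0 :=
      Derivation.apply_rename_eq_zero _ (by simp [pderiv_X])
    simp [hF, h2, pderiv_X, hij.symm] at h1
    exact hj (rename_injective _ Sum.inr_injective (by simpa using h1))
  refine ⟨F ^ m * X (Sum.inr 0) ^ (n - d * m), ?_, ?_, ?_⟩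
  · rw [bihomogeneous, mem_weightedHomogeneousSubmodule]
    convert! (hFmem.pow m).mul ((isWeightedHomogeneous_X ℂ (bidegreeWeight N)
      (Sum.inr 0)).pow (n - d * m)) using 1
    ext
    · simp [bidegreeWeight]
    · simp [bidegreeWeight, Nat.cast_sub hmn]
      ring
  · exact mul_ne_zero (pow_ne_zero _ hF0) (pow_ne_zero _ (X_ne_zero _))
  · have hFk : deltaDerivation P F = 0 := by
      simp [hF, deltaDerivation_rename_inr]
      ring
    simp [Derivation.leibniz_pow, hFk]

theorem mainTheorem11 (N d : ℕ) (hN : 1 ≤ N) (hd : 1 ≤ d)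
    (P : Fin (N + 1) → MvPolynomial (Fin (N + 1)) ℂ)
    (hP : ∀ i, (P i).IsHomogeneous d)
    (hzero : ∀ x : Fin (N + 1) → ℂ, (∀ i, MvPolynomial.eval x (P i) = 0) → x = 0)
    (m n : ℕ) :
    (Function.Injective (deltaMap P hP m n) ↔ n < d * m) ∧
    ((∃ A : PolyYX N, A ∈ bihomogeneous N m n ∧ A ≠ 0 ∧
      ∑ i, MvPolynomial.rename Sum.inr (P i) * MvPolynomial.pderiv (Sum.inl i) A = 0) ↔
        d * m ≤ n) := by
  have hker : (∃ A : PolyYX N, A ∈ bihomogeneous N m n ∧ A ≠ 0 ∧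
      ∑ i, rename Sum.inr (P i) * pderiv (Sum.inl i) A = 0) ↔ d * m ≤ n := by
    simp_rw [← deltaDerivation_apply]
    constructor
    · rintro ⟨A, hA, hA0, h⟩
      by_contra! hmn
      exact hA0 (eq_zero_of_deltaDerivation_eq_zero hd hP hzero hmn hA h)
    · exact exists_ne_zero_deltaDerivation_eq_zero hN hP hzero
  refine ⟨?_, hker⟩
  rw [← not_le, ← hker, injective_iff_map_eq_zero]
  have hval : ∀ A : bihomogeneous N m n, deltaMap P hP m n A = 0 ↔
      ∑ i, rename Sum.inr (P i) * pderiv (Sum.inl i) (A : PolyYX N) = 0 := fun A => by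
    rw [← deltaOp_apply, ← Submodule.coe_eq_zero]
    rfl
  constructor
  · rintro h ⟨A, hA, hA0, h0⟩
    exact hA0 (congrArg Subtype.val (h ⟨A, hA⟩ ((hval _).2 h0)))
  · intro h A hA
    by_contra hA0
    exact h ⟨A, A.2, fun h => hA0 (Subtype.ext h), (hval A).1 hA⟩

end
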